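/- Let $\mathcal H_A,\mathcal H_B$ be nonzero finite-dimensional Hilbert spaces and let $\mathcal N$ be a quantum channel (completely positive trace-preserving linear map) from operators on $\mathcal H_A$ to operators on $\mathcal H_B$. A channel is called entanglement-breaking (EB) if it can be written as $$\rho\mapsto\sum_\mu \pi(\mu)\sum_i \operatorname{Tr}[\Pi_{i|\mu}\rho]\,\rho'_{i,\mu}$$ (finite sums) with a probability distribution $\pi$, a POVM $\{\Pi_{i|\mu}\}_i$ for each $\mu$, and density matrices $\rho'_{i,\mu}$. A semiquantum signaling game consists of finite nonempty sets $X,Y$ (questions) and $\mathsf B$ (answers), density matrices $\xi_x$ ($x\in X$) on a finite-dimensional Hilbert space $\mathcal H_X$ and $\psi_y$ ($y\in Y$) on a finite-dimensional Hilbert space $\mathcal H_Y$, and a payoff function $\wp:\mathsf B\times X\times Y\to\mathbb R$. A correlation $p(b|x,y)$ is admissible for a channel $\mathcal M:A'\to B'$ if there are a finite quantum instrument $\{\mathcal I_i\}$ from $\mathcal H_X$ to $\mathcal H_{A'}$ (completely positive maps whose sum is trace preserving) and, for each $i$, a POVM $\{B_{b|i}\}_{b\in\mathsf B}$ on $\mathcal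 H_{B'}\otimes\mathcal H_Y$ with $$p(b|x,y)=\sum_i\operatorname{Tr}\big[\{(\mathcal M\circ\mathcal I_i)(\xi_x)\otimes\psi_y\}\,B_{b|i}\big].$$ The optimal payoff $\wp^*(\mathcal M)$ is the maximum of $\sum_{b,x,y}\wp(b,x,y)\,p(b|x,y)$ over all correlations admissible for $\mathcal M$, and the EB threshold $\wp_{\mathrm{EB}}$ is the constant value of $\wp^*$ on all EB channels, between arbitrary nonzero finite-dimensional Hilbert spaces. Then $\mathcal N$ is not entanglement-breaking if and only if there exists a semiquantum signaling game such that $\wp^*(\mathcal N)>0$ while $\wp_{\mathrm{EB}}=0$. -/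

import Mathlib

open scoped Matrix Kronecker ComplexOrder

universe u

namespace QMemory

/-! The Hilbert space of a finite-dimensional system is `ℂ^A` for a finite index type `A` (the
computational basis); operators on it are the matrices `Matrix A A ℂ`. -/

/-- Density matrices: positive semidefinite of trace one. -/
def IsDensity {A : Type*} [Fintype A] (ρ : Matrix A A ℂ) : Prop :=
  ρ.PosSemidef ∧ ρ.trace = 1

/-- A POVM with outcomes in the finite set `I`. -/
def IsPOVM {A I : Type*} [Fintype A] [DecidableEq A] [Fintype I] (E : I → Matrix A A ℂ) : Prop :=
  (∀ i, (E i).PosSemidef) ∧ ∑ i, E i = 1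

/-- The map `id_k ⊗ Φ` on `k × k` block matrices with blocks in `Matrix A A ℂ`:
`Φ` is applied to every block. -/
def ampliate {A B : Type*} (Φ : Matrix A A ℂ →ₗ[ℂ] Matrix B B ℂ) (k : ℕ)
    (M : Matrix (Fin k × A) (Fin k × A) ℂ) : Matrix (Fin k × B) (Fin k × B) ℂ :=
  Matrix.of fun p q => Φ (Matrix.of fun a a' => M (p.1, a) (q.1, a')) p.2 q.2

/-- Complete positivity: `id_k ⊗ Φ` preserves positive semidefiniteness for every `k`. -/
def IsCP {A B : Type*} (Φ : Matrix A A ℂ →ₗ[ℂ] Matrix B B ℂ) : Prop :=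
  ∀ (k : ℕ) (M : Matrix (Fin k × A) (Fin k × A) ℂ), M.PosSemidef → (ampliate Φ k M).PosSemidef

/-- Trace preservation. -/
def IsTP {A B : Type*} [Fintype A] [Fintype B] (Φ : Matrix A A ℂ →ₗ[ℂ] Matrix B B ℂ) : Prop :=
  ∀ ρ, (Φ ρ).trace = ρ.trace

/-- A quantum channel: a completely positive trace-preserving linear map. -/
structure Channel (A B : Type*) [Fintype A] [Fintype B] where
  map : Matrix A A ℂ →ₗ[ℂ] Matrix B B ℂ
  cp : IsCP map
  tp : IsTP map

/-- A quantum instrument with outcomes in the finite set `I`: completely positive maps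
whose sum is trace preserving. -/
def IsInstrument {A B I : Type*} [Fintype A] [Fintype B] [Fintype I]
    (J : I → (Matrix A A ℂ →ₗ[ℂ] Matrix B B ℂ)) : Prop :=
  (∀ i, IsCP (J i)) ∧ IsTP (∑ i, J i)

/-- Entanglement-breaking (measure-and-prepare) channels:
`N(ρ) = ∑_μ π(μ) ∑_i Tr(E_{i|μ} ρ) σ_{i,μ}` with `π` a probability distribution,
`{E_{i|μ}}_i` a POVM for each `μ`, and density matrices `σ_{i,μ}`. -/
def Channel.IsEB {A B : Type*} [Fintype A] [DecidableEq A] [Fintype B] (N : Channel A B) : Prop :=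
  ∃ (m n : ℕ) (π : Fin m → ℝ) (E : Fin m → Fin n → Matrix A A ℂ)
    (σ : Fin m → Fin n → Matrix B B ℂ),
    (∀ μ, 0 ≤ π μ) ∧ ∑ μ, π μ = 1 ∧ (∀ μ, IsPOVM (E μ)) ∧ (∀ μ i, IsDensity (σ μ i)) ∧
    ∀ ρ, N.map ρ = ∑ μ, (π μ : ℂ) • ∑ i, (E μ i * ρ).trace • σ μ i

/-- A semiquantum signaling scenario: finite nonempty sets `X`, `Y` of questions and `Ans` of
answers, and states `ξ x` on `ℂ^HX`, `ψ y` on `ℂ^HY` in which the questions are encoded. -/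
structure Scenario where
  X : Type u
  Y : Type u
  Ans : Type u
  HX : Type u
  HY : Type u
  [fintypeX : Fintype X]
  [fintypeY : Fintype Y]
  [fintypeAns : Fintype Ans]
  [fintypeHX : Fintype HX]
  [fintypeHY : Fintype HY]
  [decEqHX : DecidableEq HX]
  [decEqHY : DecidableEq HY]
  [nonemptyX : Nonempty X]
  [nonemptyY : Nonempty Y]
  [nonemptyAns : Nonempty Ans]
  ξ : X → Matrix HX HX ℂ
  ψ : Y → Matrix HY HY ℂ
  isDensity_ξ : ∀ x, IsDensity (ξ x)
  isDensity_ψ : ∀ y, IsDensity (ψ y)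

attribute [instance] Scenario.fintypeX Scenario.fintypeY Scenario.fintypeAns Scenario.fintypeHX
  Scenario.fintypeHY Scenario.decEqHX Scenario.decEqHY Scenario.nonemptyX Scenario.nonemptyY
  Scenario.nonemptyAns

/-- The correlations `p(b|x,y)` are admissible for the resource `N` in the scenario `S`:
there are a quantum instrument `{J_i}` from `ℂ^HX` to the input of `N` and, for each outcome `i`,
a POVM `{M_{b|i}}_b` on (output of `N`) ⊗ `ℂ^HY`, such that
`p(b|x,y) = ∑_i Tr[((N ∘ J_i)(ξ_x) ⊗ ψ_y) M_{b|i}]`. -/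
def Scenario.IsAdmissible (S : Scenario.{u}) {A B : Type*} [Fintype A] [Fintype B] [DecidableEq B]
    (N : Channel A B) (p : S.Ans → S.X → S.Y → ℝ) : Prop :=
  ∃ (n : ℕ) (J : Fin n → (Matrix S.HX S.HX ℂ →ₗ[ℂ] Matrix A A ℂ))
    (M : Fin n → S.Ans → Matrix (B × S.HY) (B × S.HY) ℂ),
    IsInstrument J ∧ (∀ i, IsPOVM (M i)) ∧
    ∀ b x y, (p b x y : ℂ) = ∑ i, ((N.map (J i (S.ξ x)) ⊗ₖ S.ψ y) * M i b).trace

/-- A semiquantum signaling game: a scenario together with a payoff function. -/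
structure Game extends Scenario.{u} where
  payoff : Ans → X → Y → ℝ

/-- The average payoff of the correlations `p`. -/
def Game.expectedPayoff (G : Game.{u}) (p : G.Ans → G.X → G.Y → ℝ) : ℝ :=
  ∑ b, ∑ x, ∑ y, G.payoff b x y * p b x y

/-- `v` is the optimal payoff of the resource `N`: the maximum of the average payoff over
all correlations that are admissible for `N`. -/
def Game.IsOptimalPayoff (G : Game.{u}) {A B : Type*} [Fintype A] [Fintype B] [DecidableEq B]
    (N : Channel A B) (v : ℝ) : Prop :=
  IsGreatest {w : ℝ | ∃ p, G.toScenario.IsAdmissible N p ∧ w = G.expectedPayoff p} v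

/-- `t` is the entanglement-breaking threshold of the game: the constant value of the optimal
payoff on all entanglement-breaking channels, between arbitrary finite-dimensional
(nonzero) Hilbert spaces. -/
def Game.IsEBThreshold (G : Game.{u}) (t : ℝ) : Prop :=
  ∀ (A B : Type u) [Fintype A] [DecidableEq A] [Nonempty A] [Fintype B] [DecidableEq B]
    [Nonempty B] (N : Channel A B), N.IsEB → G.IsOptimalPayoff N t

end QMemory

namespace QMemory

/-! If `N` is entanglement-breaking, its optimal payoff is the threshold itself, because a set of
reals has at most one maximum; this gives the easy direction.

For the other, evaluate maps on finite spanning sets of states to get real tables `Tr[Φ(x) y]`. The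
tables of the maps `ρ ↦ Tr[Fρ] G` with `F`, `G` densities have a compact convex hull, and a channel
whose normalised table lies in it is entanglement-breaking (`Channel.isEB_of_eq_sum_prepMap`).
Hahn-Banach therefore gives a witness `ω`, positive on `N` and nonpositive on all
measure-and-prepare maps (`Channel.exists_witness`).

The witness is then used as a payoff. With questions `x` and `yᵀ`, projecting onto the maximally
entangled state returns `Tr[N(x) y]` up to a positive factor, so the honest strategy earns a
positive amount. Over an entanglement-breaking channel every Kraus branch of every strategy is a
nonnegative combination of measure-and-prepare maps, hence earns at most 0
(`Channel.IsEB.sum_witness_nonpos`), and 0 is attained by always answering `false`.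

That a maximum exists for `N` is not immediate, since the number of instrument outcomes is
unbounded; `Game.isCompact_setOf_payoff` settles this. -/

/-! ### Convex hulls of compact sets -/

/-- In a finite-dimensional space the convex hull of a compact set is compact. -/
theorem isCompact_convexHull_of_finiteDimensional {E : Type*} [AddCommGroup E] [Module ℝ E]
    [TopologicalSpace E] [IsTopologicalAddGroup E] [ContinuousSMul ℝ E] [FiniteDimensional ℝ E]
    {s : Set E} (hs : IsCompact s) : IsCompact (convexHull ℝ s) := by
  -- Carathéodory: affinely independent families have at most `finrank + 1` members, so the hull is
  -- a finite union of continuous images of simplex × `s^m`.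
  have key : convexHull ℝ s = ⋃ m ∈ Finset.range (Module.finrank ℝ E + 2),
      (fun q : (Fin m → ℝ) × (Fin m → E) => ∑ i, q.1 i • q.2 i) ''
        (stdSimplex ℝ (Fin m) ×ˢ Set.pi Set.univ fun _ => s) := by
    apply Set.Subset.antisymm
    · intro x hx
      obtain ⟨ι, _, z, w, hz, hind, hw, hw1, hx⟩ := eq_pos_convex_span_of_mem_convexHull hx
      have hc := hind.card_le_finrank_succ
      have hc2 := Submodule.finrank_le (vectorSpan ℝ (Set.range z))
      let e := Fintype.equivFin ι
      simp only [Set.mem_iUnion, Finset.mem_range]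
      refine ⟨Fintype.card ι, by omega, (w ∘ e.symm, z ∘ e.symm), ⟨⟨fun i => (hw _).le, ?_⟩, ?_⟩, ?_⟩
      · rw [← hw1]; exact e.symm.sum_comp w
      · intro i _; exact hz ⟨_, rfl⟩
      · rw [← hx]; exact e.symm.sum_comp fun i => w i • z i
    · simp only [Set.iUnion_subset_iff]
      rintro m - _ ⟨⟨w, z⟩, ⟨⟨hw, hw1⟩, hz⟩, rfl⟩
      exact mem_convexHull_of_exists_fintype w z hw hw1 (fun i => hz i trivial) rfl
  rw [key]
  refine (Finset.range _).isCompact_biUnion fun m _ => ?_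
  refine ((isCompact_stdSimplex ℝ (Fin m)).prod (isCompact_univ_pi fun _ => hs)).image ?_
  fun_prop

/-! ### Completely positive maps and Kraus operators -/

/-- The map `ρ ↦ K ρ K†`. -/
def conjMap {A B : Type*} [Fintype A] (K : Matrix B A ℂ) : Matrix A A ℂ →ₗ[ℂ] Matrix B B ℂ where
  toFun ρ := K * ρ * Kᴴ
  map_add' ρ σ := by rw [Matrix.mul_add, Matrix.add_mul]
  map_smul' c ρ := by simp

theorem conjMap_apply {A B : Type*} [Fintype A] (K : Matrix B A ℂ) (ρ : Matrix A A ℂ) : conjMap K ρ = K * ρ * Kᴴ := rfl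

theorem IsCP.sum {A B ι : Type*} [Fintype ι] {Φ : ι → (Matrix A A ℂ →ₗ[ℂ] Matrix B B ℂ)}
    (h : ∀ i, IsCP (Φ i)) : IsCP (∑ i, Φ i) := by
  intro k M hM
  have : ampliate (∑ i, Φ i) k M = ∑ i, ampliate (Φ i) k M := by
    ext p q
    simp [ampliate, Matrix.sum_apply]
  rw [this]
  exact Matrix.posSemidef_sum _ fun i _ => h i k M hM

section Positivity

variable {A B : Type*} [Fintype A] [Fintype B]

theorem exists_eq_conjTranspose_mul_self {M : Matrix A A ℂ} (h : M.PosSemidef) :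
    ∃ R : Matrix A A ℂ, M = Rᴴ * R := by
  classical
  open scoped MatrixOrder Matrix.Norms.L2Operator in
  exact CStarAlgebra.nonneg_iff_eq_star_mul_self.mp h.nonneg

theorem trace_mul_nonneg {F G : Matrix A A ℂ} (hF : F.PosSemidef) (hG : G.PosSemidef) :
    0 ≤ (F * G).trace := by
  obtain ⟨R, rfl⟩ := exists_eq_conjTranspose_mul_self hF
  rw [Matrix.mul_assoc, Matrix.trace_mul_comm]
  exact (hG.mul_mul_conjTranspose_same R).trace_nonneg

theorem ofReal_re_of_nonneg {z : ℂ} (h : 0 ≤ z) : ((z.re : ℝ) : ℂ) = z :=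
  Complex.ext rfl (by simpa using (Complex.le_def.1 h).2)

/-- The ampliation is again a conjugation, by `1 ⊗ K`. -/
theorem isCP_conjMap (K : Matrix B A ℂ) : IsCP (conjMap K) := by
  intro k M hM
  have : ampliate (conjMap K) k M =
      ((1 : Matrix (Fin k) (Fin k) ℂ) ⊗ₖ K) * M * ((1 : Matrix (Fin k) (Fin k) ℂ) ⊗ₖ K)ᴴ := by
    ext ⟨i, b⟩ ⟨j, b'⟩
    simp [ampliate, conjMap_apply, Matrix.mul_apply, Fintype.sum_prod_type, Matrix.one_apply,
      Finset.sum_mul, ite_mul]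
    rw [Finset.sum_comm (s := (Finset.univ : Finset (Fin k)))]
    simp [apply_ite]
  rw [this]
  exact hM.mul_mul_conjTranspose_same _

/-- Kraus decomposition of a completely positive map. -/
theorem IsCP.exists_kraus {Φ : Matrix A A ℂ →ₗ[ℂ] Matrix B B ℂ} (h : IsCP Φ) :
    ∃ (n : ℕ) (K : Fin n → Matrix B A ℂ), Φ = ∑ i, conjMap (K i) := by
  classical
  let e := (Fintype.equivFin A).symm
  -- The unnormalised maximally entangled vector: ampliating its rank-one matrix gives the Choi
  -- matrix of `Φ`, and the conjugated rows of a factor `R` of that matrix, reshaped, are the Kraus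
  -- operators.
  let v : Fin (Fintype.card A) × A → ℂ := fun p => if e p.1 = p.2 then 1 else 0
  obtain ⟨R, hR⟩ := exists_eq_conjTranspose_mul_self
    (h _ _ (Matrix.posSemidef_vecMulVec_self_star v))
  let f := (Fintype.equivFin (Fin (Fintype.card A) × B)).symm
  let L : Fin (Fintype.card A) × B → Matrix B A ℂ :=
    fun r => Matrix.of fun b a => star (R r (e.symm a, b))
  have hC : ∀ a a' b b', Φ (Matrix.single a a' 1) b b' =
      ∑ r, L r b a * star (L r b' a') := by
    intro a a' b b'
    have := congrFun (congrFun hR (e.symm a, b)) (e.symm a', b')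
    simp only [ampliate, Matrix.of_apply, Matrix.mul_apply, Matrix.conjTranspose_apply] at this
    simp only [L, Matrix.of_apply, star_star]
    rw [← this]
    have hs : Matrix.single a a' (1 : ℂ) =
        Matrix.of fun c c' => Matrix.vecMulVec v (star v) (e.symm a, c) (e.symm a', c') := by
      ext c c'
      simp [v, Matrix.vecMulVec_apply, Matrix.single_apply, ite_and]
      split_ifs <;> rfl
    rw [hs]
  refine ⟨_, fun i => L (f i), LinearMap.ext fun ρ => ?_⟩
  rw [f.sum_comp fun r => conjMap (L r)]
  conv_lhs => rw [Matrix.matrix_eq_sum_single ρ]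
  ext b b'
  simp only [map_sum, Matrix.sum_apply, LinearMap.sum_apply, conjMap_apply]
  have : ∀ a a', Φ (Matrix.single a a' (ρ a a')) b b' =
      ∑ r, ρ a a' * (L r b a * star (L r b' a')) := by
    intro a a'
    rw [← Finset.mul_sum, ← hC, ← smul_eq_mul, ← Matrix.smul_apply, ← map_smul, Matrix.smul_single]
    simp
  simp only [this, Matrix.mul_apply, Matrix.conjTranspose_apply, Finset.sum_mul]
  rw [Finset.sum_comm]
  conv_rhs => rw [Finset.sum_comm]
  refine Finset.sum_congr rfl fun a _ => ?_
  rw [Finset.sum_comm]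
  exact Finset.sum_congr rfl fun _ _ => Finset.sum_congr rfl fun _ _ => by ring

theorem IsCP.posSemidef {Φ : Matrix A A ℂ →ₗ[ℂ] Matrix B B ℂ} (h : IsCP Φ) {ρ : Matrix A A ℂ}
    (hρ : ρ.PosSemidef) : (Φ ρ).PosSemidef := by
  obtain ⟨n, K, rfl⟩ := h.exists_kraus
  rw [LinearMap.sum_apply]
  exact Matrix.posSemidef_sum _ fun i _ => hρ.mul_mul_conjTranspose_same (K i)

theorem trace_sum_conjMap {ι : Type*} [Fintype ι] (K : ι → Matrix B A ℂ) (ρ : Matrix A A ℂ) :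
    ((∑ i, conjMap (K i)) ρ).trace = ((∑ i, (K i)ᴴ * K i) * ρ).trace := by
  simp only [LinearMap.sum_apply, Matrix.trace_sum, Finset.sum_mul, conjMap_apply]
  refine Finset.sum_congr rfl fun i _ => ?_
  rw [Matrix.trace_mul_comm, Matrix.mul_assoc]

/-- By nondegeneracy of the trace pairing. -/
theorem isTP_sum_conjMap [DecidableEq A] {ι : Type*} [Fintype ι] (K : ι → Matrix B A ℂ) :
    IsTP (∑ i, conjMap (K i)) ↔ ∑ i, (K i)ᴴ * K i = 1 := by
  rw [Matrix.ext_iff_trace_mul_right]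
  simp only [IsTP, trace_sum_conjMap, one_mul]

end Positivity

/-! ### Strategies in Kraus form -/

section Admissible

variable {A B : Type*} [Fintype A] [Fintype B]

/-- An instrument may be refined to one whose branches are single Kraus operators. -/
theorem Scenario.IsAdmissible.exists_kraus [DecidableEq B] {S : Scenario.{u}} {N : Channel A B}
    {p : S.Ans → S.X → S.Y → ℝ} (h : S.IsAdmissible N p) :
    ∃ (n : ℕ) (K : Fin n → Matrix A S.HX ℂ)
      (M : Fin n → S.Ans → Matrix (B × S.HY) (B × S.HY) ℂ),
      ∑ i, (K i)ᴴ * K i = 1 ∧ (∀ i, IsPOVM (M i)) ∧ ∀ b x y, (p b x y : ℂ) =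
        ∑ i, ((N.map (conjMap (K i) (S.ξ x)) ⊗ₖ S.ψ y) * M i b).trace := by
  obtain ⟨n, J, M, ⟨hJ, hTP⟩, hM, hp⟩ := h
  choose m K hK using fun i => (hJ i).exists_kraus
  -- Each Kraus operator becomes its own outcome; it keeps the measurement of the outcome it came
  -- from.
  let e := (Fintype.equivFin (Σ i, Fin (m i))).symm
  refine ⟨_, fun i => K (e i).1 (e i).2, fun i => M (e i).1, ?_, fun i => hM _, fun b x y => ?_⟩
  · rw [← isTP_sum_conjMap, e.sum_comp fun s => conjMap (K s.1 s.2), Fintype.sum_sigma]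
    simpa only [← hK] using hTP
  · rw [hp, e.sum_comp fun s => ((N.map (conjMap (K s.1 s.2) (S.ξ x)) ⊗ₖ S.ψ y) * M s.1 b).trace,
      Fintype.sum_sigma]
    refine Finset.sum_congr rfl fun i _ => ?_
    conv_lhs => rw [hK i, LinearMap.sum_apply, map_sum]
    rw [← Matrix.trace_sum]
    dsimp only
    rw [← Finset.sum_mul]
    congr 2
    ext ⟨b, y⟩ ⟨b', y'⟩
    simp [Matrix.kroneckerMap_apply, Matrix.sum_apply, Finset.sum_mul]

theorem trace_kronecker_mul_nonneg (S : Scenario.{u}) (N : Channel A B) (K : Matrix A S.HX ℂ)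
    {F : Matrix (B × S.HY) (B × S.HY) ℂ} (hF : F.PosSemidef) (x : S.X) (y : S.Y) :
    0 ≤ ((N.map (conjMap K (S.ξ x)) ⊗ₖ S.ψ y) * F).trace :=
  trace_mul_nonneg ((N.cp.posSemidef ((isCP_conjMap K).posSemidef (S.isDensity_ξ x).1)).kronecker
    (S.isDensity_ψ y).1) hF

/-- The traces are nonnegative, so passing to real parts loses nothing. -/
theorem Scenario.isAdmissible_of_kraus [DecidableEq B] {S : Scenario.{u}} {N : Channel A B}
    {p : S.Ans → S.X → S.Y → ℝ} {ι : Type*} [Fintype ι] (K : ι → Matrix A S.HX ℂ)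
    (M : ι → S.Ans → Matrix (B × S.HY) (B × S.HY) ℂ) (hK : ∑ i, (K i)ᴴ * K i = 1)
    (hM : ∀ i, IsPOVM (M i))
    (hp : ∀ b x y, p b x y =
      ∑ i, ((N.map (conjMap (K i) (S.ξ x)) ⊗ₖ S.ψ y) * M i b).trace.re) :
    S.IsAdmissible N p := by
  let e := (Fintype.equivFin ι).symm
  refine ⟨_, fun i => conjMap (K (e i)), fun i => M (e i), ⟨fun i => isCP_conjMap _, ?_⟩,
    fun i => hM _, fun b x y => ?_⟩
  · rw [e.sum_comp fun i => conjMap (K i)]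
    exact (isTP_sum_conjMap K).2 hK
  · rw [hp, e.sum_comp fun i => ((N.map (conjMap (K i) (S.ξ x)) ⊗ₖ S.ψ y) * M i b).trace,
      Complex.ofReal_sum]
    exact Finset.sum_congr rfl fun i _ =>
      ofReal_re_of_nonneg (trace_kronecker_mul_nonneg S N (K i) ((hM i).1 b) x y)

theorem Scenario.nonempty_HX (S : Scenario.{u}) : Nonempty S.HX := by
  by_contra h
  rw [not_nonempty_iff] at h
  simpa [Matrix.trace] using (S.isDensity_ξ (Classical.arbitrary _)).2

/-- Answering deterministically is always possible. -/
theorem Scenario.isAdmissible_const [Nonempty A] [DecidableEq A] [DecidableEq B] (S : Scenario.{u})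
    [DecidableEq S.Ans] (N : Channel A B) (b₀ : S.Ans) :
    S.IsAdmissible N fun b _ _ => if b = b₀ then 1 else 0 := by
  let a₀ : A := Classical.arbitrary A
  -- The operators `|a₀⟩⟨i|` discard the question and reset to a fixed basis state.
  have hK : ∑ i : S.HX, (Matrix.single a₀ i (1 : ℂ))ᴴ * Matrix.single a₀ i (1 : ℂ) = 1 := by
    ext i j
    simp [Matrix.sum_apply, Matrix.one_apply, Matrix.single_apply, ite_and, eq_comm]
  refine Scenario.isAdmissible_of_kraus (fun i : S.HX => Matrix.single a₀ i 1)
    (fun _ b => if b = b₀ then 1 else 0) hK (fun i => ⟨fun b => ?_, by simp⟩) fun b x y => ?_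
  · dsimp only
    split_ifs
    · exact Matrix.PosSemidef.one
    · exact Matrix.PosSemidef.zero
  · split_ifs
    · simp only [Matrix.trace_kronecker, (S.isDensity_ψ y).2, mul_one,
        N.tp (conjMap _ _)]
      rw [← Complex.re_sum, ← Matrix.trace_sum, ← LinearMap.sum_apply, trace_sum_conjMap, hK]
      simp [(S.isDensity_ξ x).2]
    · simp

/-- The payoff contributed by a Kraus operator followed by a measurement. -/
noncomputable def Game.krausPayoff (G : Game.{u}) (N : Channel A B) (K : Matrix A G.HX ℂ)
    (M : G.Ans → Matrix (B × G.HY) (B × G.HY) ℂ) : ℝ :=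
  ∑ b, ∑ x, ∑ y, G.payoff b x y *
    ((N.map (conjMap K (G.ξ x)) ⊗ₖ G.ψ y) * M b).trace.re

theorem Game.expectedPayoff_eq_sum (G : Game.{u}) (N : Channel A B) {ι : Type*} [Fintype ι]
    (K : ι → Matrix A G.HX ℂ) (M : ι → G.Ans → Matrix (B × G.HY) (B × G.HY) ℂ) :
    G.expectedPayoff (fun b x y =>
      ∑ i, ((N.map (conjMap (K i) (G.ξ x)) ⊗ₖ G.ψ y) * M i b).trace.re) =
      ∑ i, G.krausPayoff N (K i) (M i) := by
  simp only [Game.expectedPayoff, Game.krausPayoff, Finset.mul_sum]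
  symm
  rw [Finset.sum_comm]
  refine Finset.sum_congr rfl fun b _ => ?_
  rw [Finset.sum_comm]
  refine Finset.sum_congr rfl fun x _ => ?_
  rw [Finset.sum_comm]

/-- The set of attainable payoffs in terms of Kraus operators. -/
theorem Game.setOf_payoff_eq [DecidableEq B] (G : Game.{u}) (N : Channel A B) :
    {w : ℝ | ∃ p, G.toScenario.IsAdmissible N p ∧ w = G.expectedPayoff p} =
    {w : ℝ | ∃ (n : ℕ) (K : Fin n → Matrix A G.HX ℂ)
      (M : Fin n → G.Ans → Matrix (B × G.HY) (B × G.HY) ℂ),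
      ∑ i, (K i)ᴴ * K i = 1 ∧ (∀ i, IsPOVM (M i)) ∧ w = ∑ i, G.krausPayoff N (K i) (M i)} := by
  ext w
  constructor
  · rintro ⟨p, hp, rfl⟩
    obtain ⟨n, K, M, hK, hM, h⟩ := hp.exists_kraus
    refine ⟨n, K, M, hK, hM, ?_⟩
    rw [← Game.expectedPayoff_eq_sum]
    congr 1
    ext b x y
    rw [← Complex.re_sum, ← h, Complex.ofReal_re]
  · rintro ⟨n, K, M, hK, hM, rfl⟩
    exact ⟨_, Scenario.isAdmissible_of_kraus K M hK hM fun _ _ _ => rfl,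
      (G.expectedPayoff_eq_sum N K M).symm⟩

end Admissible

/-! ### Compactness of the set of payoffs -/

section Compactness

theorem conjTranspose_smul_mul_smul {A B : Type*} [Fintype B] (t : ℝ) (K : Matrix B A ℂ) :
    ((t : ℂ) • K)ᴴ * ((t : ℂ) • K) = (t ^ 2) • (Kᴴ * K) := by
  ext i j
  simp [Matrix.conjTranspose_smul, pow_two, mul_assoc]

variable {A B : Type*} [Fintype A] [Fintype B]

theorem trace_conjTranspose_mul_self_eq (R : Matrix B A ℂ) :
    (Rᴴ * R).trace = ((∑ a, ∑ b, ‖R b a‖ ^ 2 : ℝ) : ℂ) := by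
  simp [Matrix.trace, Matrix.mul_apply, Complex.conj_mul']

/-- A closed set of families of matrices with bounded Frobenius norm is compact. -/
theorem isCompact_of_trace_le {ι : Type*} {s : Set (ι → Matrix B A ℂ)} (hs : IsClosed s) (c : ℝ)
    (h : ∀ R ∈ s, ∀ i, (((R i)ᴴ * R i).trace).re ≤ c) : IsCompact s := by
  have hc : IsCompact (Set.pi Set.univ fun _ : ι => Set.pi Set.univ fun _ : B =>
      Set.pi Set.univ fun _ : A => Metric.closedBall (0 : ℂ) (1 + c)) :=
    isCompact_univ_pi fun _ => isCompact_univ_pi fun _ => isCompact_univ_pi fun _ =>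
      isCompact_closedBall _ _
  refine hc.of_isClosed_subset hs fun (R : ι → Matrix B A ℂ) hR i _ b _ a _ => ?_
  have h1 := h R hR i
  rw [trace_conjTranspose_mul_self_eq, Complex.ofReal_re] at h1
  have h2 : ‖R i b a‖ ^ 2 ≤ ∑ a, ∑ b, ‖R i b a‖ ^ 2 :=
    (Finset.single_le_sum (f := fun b => ‖R i b a‖ ^ 2) (fun _ _ => sq_nonneg _)
      (Finset.mem_univ b)).trans
      (Finset.single_le_sum (f := fun a => ∑ b, ‖R i b a‖ ^ 2)
        (fun _ _ => Finset.sum_nonneg fun _ _ => sq_nonneg _) (Finset.mem_univ a))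
  rw [mem_closedBall_zero_iff]
  -- `2r ≤ 1 + r² ≤ 1 + c` bounds the entry without a square root of `c`.
  nlinarith [norm_nonneg (R i b a), sq_nonneg (‖R i b a‖ - 1)]

/-- Factoring each effect as `R†R` makes this set a continuous image of a closed bounded set of
families `R`. -/
theorem isCompact_setOf_isPOVM {I : Type*} [DecidableEq A] [Fintype I] :
    IsCompact {E : I → Matrix A A ℂ | IsPOVM E} := by
  have hc : IsCompact {R : I → Matrix A A ℂ | ∑ i, (R i)ᴴ * R i = 1} := by
    refine isCompact_of_trace_le (isClosed_eq (by fun_prop) continuous_const) (Fintype.card A) ?_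
    intro R hR i
    have h1 : (∑ i, ((R i)ᴴ * R i).trace).re = Fintype.card A := by
      rw [← Matrix.trace_sum, hR]; simp
    rw [← h1, Complex.re_sum]
    exact Finset.single_le_sum (f := fun i => (((R i)ᴴ * R i).trace).re)
      (fun i _ => (Complex.le_def.1 (Matrix.posSemidef_conjTranspose_mul_self (R i)).trace_nonneg).1)
      (Finset.mem_univ i)
  convert hc.image (f := fun R i => (R i)ᴴ * R i) (by fun_prop) using 1
  ext E
  constructor
  · rintro ⟨h1, h2⟩
    choose R hR using fun i => exists_eq_conjTranspose_mul_self (h1 i)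
    exact ⟨R, show ∑ i, (R i)ᴴ * R i = 1 by simpa only [← hR] using h2, funext fun i => (hR i).symm⟩
  · rintro ⟨R, hR, rfl⟩
    exact ⟨fun i => Matrix.posSemidef_conjTranspose_mul_self _, hR⟩

theorem isCompact_setOf_trace_conjTranspose_mul_self_eq_one :
    IsCompact {K : Matrix B A ℂ | (Kᴴ * K).trace = 1} := by
  have hc : IsCompact {R : Unit → Matrix B A ℂ | ((R ())ᴴ * R ()).trace = 1} :=
    isCompact_of_trace_le (isClosed_eq (by fun_prop) continuous_const) 1
      fun R hR i => by
        have : ((R i)ᴴ * R i).trace = 1 := hR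
        simp [this]
  convert hc.image (f := fun R => R ()) (by fun_prop) using 1
  ext K
  exact ⟨fun h => ⟨fun _ => K, h, rfl⟩, by rintro ⟨R, hR, rfl⟩; exact hR⟩

theorem isCompact_setOf_isDensity : IsCompact {ρ : Matrix A A ℂ | IsDensity ρ} := by
  convert (isCompact_setOf_trace_conjTranspose_mul_self_eq_one (A := A) (B := A)).image
    (f := fun R => Rᴴ * R) (by fun_prop) using 1
  ext ρ
  constructor
  · rintro ⟨h1, h2⟩
    obtain ⟨R, rfl⟩ := exists_eq_conjTranspose_mul_self h1
    exact ⟨R, h2, rfl⟩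
  · rintro ⟨R, hR, rfl⟩
    exact ⟨Matrix.posSemidef_conjTranspose_mul_self _, hR⟩

theorem Game.continuous_krausPayoff (G : Game.{u}) (N : Channel A B) :
    Continuous fun q : Matrix A G.HX ℂ × (G.Ans → Matrix (B × G.HY) (B × G.HY) ℂ) =>
      G.krausPayoff N q.1 q.2 := by
  have hN : Continuous N.map := N.map.continuous_of_finiteDimensional
  have h1 : ∀ x, Continuous fun q : Matrix A G.HX ℂ ×
      (G.Ans → Matrix (B × G.HY) (B × G.HY) ℂ) => N.map (conjMap q.1 (G.ξ x)) :=
    fun x => hN.comp (by simp only [conjMap_apply]; fun_prop)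
  unfold Game.krausPayoff
  refine continuous_finsetSum _ fun b _ => continuous_finsetSum _ fun x _ =>
    continuous_finsetSum _ fun y _ => continuous_const.mul (Complex.continuous_re.comp
      (Continuous.matrix_trace (Continuous.matrix_mul ?_ (by fun_prop))))
  exact continuous_pi fun i => continuous_pi fun j =>
    ((h1 x).matrix_elem i.1 j.1).mul continuous_const

theorem Game.krausPayoff_smul (G : Game.{u}) (N : Channel A B) (t : ℝ) (K : Matrix A G.HX ℂ)
    (M : G.Ans → Matrix (B × G.HY) (B × G.HY) ℂ) :
    G.krausPayoff N ((t : ℂ) • K) M = t ^ 2 * G.krausPayoff N K M := by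
  have h : ∀ ρ, conjMap ((t : ℂ) • K) ρ = ((t ^ 2 : ℝ) : ℂ) • conjMap K ρ := by
    intro ρ
    rw [conjMap_apply, conjMap_apply, pow_two, Complex.ofReal_mul, mul_smul]
    simp [Matrix.conjTranspose_smul]
  simp only [Game.krausPayoff, h, map_smul, Matrix.smul_kronecker, Matrix.smul_mul,
    Matrix.trace_smul, smul_eq_mul, Complex.re_ofReal_mul, Finset.mul_sum]
  exact Finset.sum_congr rfl fun _ _ => Finset.sum_congr rfl fun _ _ =>
    Finset.sum_congr rfl fun _ _ => by ring

/-- Payoff and `K†K` both scale quadratically in `K`. Normalising each branch to `Tr K†K = 1` turns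
a strategy with any number of branches into a convex combination of points `(K†K, payoff)` from one
compact set. The constraint `∑ K†K = 1` becomes a closed condition on the first coordinate of the
hull. -/
theorem Game.isCompact_setOf_payoff [DecidableEq B] [Nonempty A] (G : Game.{u}) (N : Channel A B) :
    IsCompact {w : ℝ | ∃ p, G.toScenario.IsAdmissible N p ∧ w = G.expectedPayoff p} := by
  classical
  rw [G.setOf_payoff_eq N]
  have := G.toScenario.nonempty_HX
  obtain ⟨D, hD⟩ : ∃ D : ℝ, D = Fintype.card G.HX := ⟨_, rfl⟩
  have hD0 : 0 < D := by rw [hD]; exact_mod_cast Fintype.card_pos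
  -- The weights `Tr K†K` sum to `D`; dividing by `D` makes them convex, whence first coordinate
  -- `D⁻¹ • 1` and payoff `D * q.2`.
  let Q : Set (Matrix G.HX G.HX ℂ × ℝ) :=
    (fun q : Matrix A G.HX ℂ × (G.Ans → Matrix (B × G.HY) (B × G.HY) ℂ) =>
      (q.1ᴴ * q.1, G.krausPayoff N q.1 q.2)) '' ({K | (Kᴴ * K).trace = 1} ×ˢ {M | IsPOVM M})
  have hQ : IsCompact (convexHull ℝ Q) := by
    refine isCompact_convexHull_of_finiteDimensional
      ((isCompact_setOf_trace_conjTranspose_mul_self_eq_one.prod isCompact_setOf_isPOVM).image ?_)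
    exact Continuous.prodMk (by fun_prop) (G.continuous_krausPayoff N)
  have hcl : IsClosed {q : Matrix G.HX G.HX ℂ × ℝ | q.1 = D⁻¹ • 1} :=
    isClosed_eq continuous_fst continuous_const
  convert (hQ.inter_right hcl).image (f := fun q => D * q.2) (by fun_prop) using 1
  ext w
  constructor
  · rintro ⟨n, K, M, hK, hM, rfl⟩
    let t : Fin n → ℝ := fun i => (((K i)ᴴ * K i).trace).re
    have ht0 : ∀ i, 0 ≤ t i := fun i =>
      (Complex.le_def.1 (Matrix.posSemidef_conjTranspose_mul_self (K i)).trace_nonneg).1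
    have htK : ∀ i, ((K i)ᴴ * K i).trace = (t i : ℂ) := fun i =>
      (ofReal_re_of_nonneg (Matrix.posSemidef_conjTranspose_mul_self (K i)).trace_nonneg).symm
    have ht1 : ∑ i, t i = D := by
      have : (∑ i, ((K i)ᴴ * K i).trace).re = Fintype.card G.HX := by
        rw [← Matrix.trace_sum, hK]; simp
      rw [hD, ← this, Complex.re_sum]
    have hnorm : ∀ i, ∃ L : Matrix A G.HX ℂ, (Lᴴ * L).trace = 1 ∧
        K i = ((Real.sqrt (t i) : ℝ) : ℂ) • L := by
      intro i
      rcases (ht0 i).eq_or_lt with h | h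
      · have hK0 : K i = 0 := by
          rw [← Matrix.trace_conjTranspose_mul_self_eq_zero_iff, htK, ← h]; simp
        -- A vanishing branch has weight zero, so any normalised operator will do.
        refine ⟨Matrix.single (Classical.arbitrary A) (Classical.arbitrary G.HX) 1, ?_, ?_⟩
        · simp
        · rw [← h, hK0]; simp
      · refine ⟨(((Real.sqrt (t i))⁻¹ : ℝ) : ℂ) • K i, ?_, ?_⟩
        · rw [conjTranspose_smul_mul_smul, Matrix.trace_smul, htK, inv_pow, Real.sq_sqrt (ht0 i),
            Complex.real_smul, ← Complex.ofReal_mul, inv_mul_cancel₀ h.ne', Complex.ofReal_one]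
        · rw [smul_smul, ← Complex.ofReal_mul, mul_inv_cancel₀ (Real.sqrt_pos.2 h).ne']; simp
    choose L hL1 hL2 using hnorm
    refine ⟨∑ i, (D⁻¹ * t i) • ((L i)ᴴ * L i, G.krausPayoff N (L i) (M i)), ⟨?_, ?_⟩, ?_⟩
    · refine mem_convexHull_of_exists_fintype (fun i => D⁻¹ * t i) _
        (fun i => mul_nonneg (inv_nonneg.2 hD0.le) (ht0 i)) ?_
        (fun i => ⟨(L i, M i), ⟨hL1 i, hM i⟩, rfl⟩) rfl
      rw [← Finset.mul_sum, ht1, inv_mul_cancel₀ hD0.ne']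
    · have : ∀ i, (K i)ᴴ * K i = t i • ((L i)ᴴ * L i) := fun i => by
        conv_lhs => rw [hL2 i]
        rw [conjTranspose_smul_mul_smul, Real.sq_sqrt (ht0 i)]
      simp only [Set.mem_ofPred_eq, Prod.fst_sum, Prod.smul_fst, mul_smul, ← this]
      rw [← Finset.smul_sum, hK]
    · simp only [Prod.snd_sum, Prod.smul_snd, smul_eq_mul, Finset.mul_sum]
      refine Finset.sum_congr rfl fun i _ => ?_
      conv_rhs => rw [hL2 i]
      rw [G.krausPayoff_smul, Real.sq_sqrt (ht0 i)]
      field_simp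
  · rintro ⟨q, ⟨hq, hq1⟩, rfl⟩
    obtain ⟨ι, _, w, z, hw, hw1, hz, rfl⟩ := mem_convexHull_iff_exists_fintype.1 hq
    choose r hr hrz using hz
    let e := (Fintype.equivFin ι).symm
    refine ⟨_, fun i => ((Real.sqrt (D * w (e i)) : ℝ) : ℂ) • (r (e i)).1, fun i => (r (e i)).2,
      ?_, fun i => (hr _).2, ?_⟩
    · rw [e.sum_comp fun i => (((Real.sqrt (D * w i) : ℝ) : ℂ) • (r i).1)ᴴ *
        (((Real.sqrt (D * w i) : ℝ) : ℂ) • (r i).1)]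
      have h2 : D • (∑ i, w i • z i).1 = 1 := by
        rw [show (∑ i, w i • z i).1 = D⁻¹ • 1 from hq1, smul_smul, mul_inv_cancel₀ hD0.ne', one_smul]
      rw [← h2, Prod.fst_sum, Finset.smul_sum]
      refine Finset.sum_congr rfl fun i _ => ?_
      rw [conjTranspose_smul_mul_smul, Real.sq_sqrt (mul_nonneg hD0.le (hw i)), ← hrz, mul_smul]
      rfl
    · rw [e.sum_comp fun i => G.krausPayoff N (((Real.sqrt (D * w i) : ℝ) : ℂ) • (r i).1) (r i).2]
      simp only [Prod.snd_sum, Finset.mul_sum]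
      refine Finset.sum_congr rfl fun i _ => ?_
      rw [G.krausPayoff_smul, Real.sq_sqrt (mul_nonneg hD0.le (hw i)), ← hrz, mul_assoc]
      rfl

/-- The optimal payoff of a channel in a game is attained. -/
theorem Game.exists_isOptimalPayoff [DecidableEq B] [Nonempty A] (G : Game.{u}) (N : Channel A B) :
    ∃ v, G.IsOptimalPayoff N v := by
  classical
  refine (G.isCompact_setOf_payoff N).exists_isGreatest ?_
  exact ⟨_, _, G.toScenario.isAdmissible_const N (Classical.arbitrary _), rfl⟩

end Compactness

/-! ### Separating a channel from measure-and-prepare maps -/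

section Witness

variable {A B : Type*} [Fintype A] [Fintype B]

theorem exists_isDensity [Nonempty A] : ∃ ρ : Matrix A A ℂ, IsDensity ρ := by
  classical
  refine ⟨Matrix.diagonal (Pi.single (Classical.arbitrary A) 1), Matrix.PosSemidef.diagonal ?_, ?_⟩
  · exact Pi.single_nonneg.2 zero_le_one
  · simp [Matrix.trace_diagonal]

/-- A positive semidefinite matrix is a nonnegative multiple of a density matrix. -/
theorem exists_eq_smul_isDensity [Nonempty A] {F : Matrix A A ℂ} (hF : F.PosSemidef) :
    ∃ (r : ℝ) (ρ : Matrix A A ℂ), 0 ≤ r ∧ IsDensity ρ ∧ F = (r : ℂ) • ρ := by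
  have htr := ofReal_re_of_nonneg hF.trace_nonneg
  have h0 := (Complex.le_def.1 hF.trace_nonneg).1
  rcases eq_or_ne F 0 with rfl | hne
  · obtain ⟨ρ, hρ⟩ := exists_isDensity (A := A)
    exact ⟨0, ρ, le_rfl, hρ, by simp⟩
  · have hne' : F.trace ≠ 0 := fun h => hne (hF.trace_eq_zero_iff.1 h)
    refine ⟨F.trace.re, F.trace⁻¹ • F, h0, ⟨hF.smul ?_, ?_⟩, ?_⟩
    · rw [← htr, ← Complex.ofReal_inv]
      exact Complex.zero_le_real.2 (inv_nonneg.2 h0)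
    · rw [Matrix.trace_smul, smul_eq_mul, inv_mul_cancel₀ hne']
    · rw [htr, smul_smul, mul_inv_cancel₀ hne', one_smul]

/-- Finitely many density matrices span the space of all matrices. -/
theorem exists_finset_isDensity_span_eq_top [Nonempty A] :
    ∃ s : Finset (Matrix A A ℂ), (∀ ρ ∈ s, IsDensity ρ) ∧
      Submodule.span ℂ (s : Set (Matrix A A ℂ)) = ⊤ := by
  classical
  have hspan : Submodule.span ℂ {ρ : Matrix A A ℂ | IsDensity ρ} = ⊤ := by
    have h : Submodule.span ℂ {F : Matrix A A ℂ | F.PosSemidef} = ⊤ := by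
      open scoped MatrixOrder Matrix.Norms.L2Operator in
      simpa only [Matrix.nonneg_iff_posSemidef] using
        CStarAlgebra.span_nonneg (A := Matrix A A ℂ)
    rw [eq_top_iff, ← h, Submodule.span_le]
    intro F hF
    obtain ⟨r, ρ, -, hρ, rfl⟩ := exists_eq_smul_isDensity hF
    exact Submodule.smul_mem _ _ (Submodule.subset_span hρ)
  obtain ⟨b, hb, hbs, hli⟩ := exists_linearIndependent ℂ {ρ : Matrix A A ℂ | IsDensity ρ}
  have hfin : b.Finite := hli.setFinite
  refine ⟨hfin.toFinset, fun ρ hρ => hb (by simpa using hρ), ?_⟩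
  rw [Set.Finite.coe_toFinset, hbs, hspan]

/-- The map `ρ ↦ Tr[F ρ] G`. -/
def prepMap (F : Matrix A A ℂ) (G : Matrix B B ℂ) : Matrix A A ℂ →ₗ[ℂ] Matrix B B ℂ where
  toFun ρ := (F * ρ).trace • G
  map_add' ρ σ := by rw [Matrix.mul_add, Matrix.trace_add, add_smul]
  map_smul' c ρ := by rw [Matrix.mul_smul, Matrix.trace_smul, smul_assoc, RingHom.id_apply]

/-- One value of `μ` suffices; the completeness relation `∑ F i = 1` is forced by trace preservation
of `N`, as each `G i` has trace one. -/
theorem Channel.isEB_of_eq_sum_prepMap [DecidableEq A] {N : Channel A B} {ι : Type*} [Fintype ι]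
    (F : ι → Matrix A A ℂ) (G : ι → Matrix B B ℂ) (hF : ∀ i, (F i).PosSemidef)
    (hG : ∀ i, IsDensity (G i)) (h : N.map = ∑ i, prepMap (F i) (G i)) : N.IsEB := by
  let e := (Fintype.equivFin ι).symm
  refine ⟨1, _, fun _ => 1, fun _ i => F (e i), fun _ i => G (e i), fun _ => zero_le_one, by simp,
    fun _ => ⟨fun i => hF _, ?_⟩, fun _ i => hG _, fun ρ => ?_⟩
  · rw [e.sum_comp F, Matrix.ext_iff_trace_mul_right]
    intro ρ
    rw [one_mul, ← N.tp ρ, h, LinearMap.sum_apply, Matrix.trace_sum, Finset.sum_mul,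
      Matrix.trace_sum]
    refine Finset.sum_congr rfl fun i _ => ?_
    change _ = ((F i * ρ).trace • G i).trace
    rw [Matrix.trace_smul, (hG i).2, smul_eq_mul, mul_one]
  · simp only [Finset.univ_unique, Finset.sum_singleton, Complex.ofReal_one, one_smul]
    rw [e.sum_comp fun i => (F i * ρ).trace • G i, h, LinearMap.sum_apply]
    rfl

/-- The table of the numbers `Tr[Φ(x) y]` for `x ∈ s`, `y ∈ t`. -/
noncomputable def corrTable (s : Finset (Matrix A A ℂ)) (t : Finset (Matrix B B ℂ))
    (Φ : Matrix A A ℂ →ₗ[ℂ] Matrix B B ℂ) : s × t → ℝ :=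
  fun q => (Φ q.1 * q.2).trace.re

theorem corrTable_prepMap (s : Finset (Matrix A A ℂ)) (t : Finset (Matrix B B ℂ))
    (F : Matrix A A ℂ) (G : Matrix B B ℂ) (q : s × t) :
    corrTable s t (prepMap F G) q =
      ((F * (q.1 : Matrix A A ℂ)).trace * (G * (q.2 : Matrix B B ℂ)).trace).re := by
  simp [corrTable, prepMap]

theorem corrTable_smul {A B : Type*} [Fintype B] (s : Finset (Matrix A A ℂ)) (t : Finset (Matrix B B ℂ)) (r : ℝ)
    (Φ : Matrix A A ℂ →ₗ[ℂ] Matrix B B ℂ) :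
    corrTable s t ((r : ℂ) • Φ) = r • corrTable s t Φ := by
  ext q
  simp [corrTable]

theorem corrTable_sum {A B : Type*} [Fintype B] (s : Finset (Matrix A A ℂ)) (t : Finset (Matrix B B ℂ)) {ι : Type*}
    [Fintype ι] (Φ : ι → (Matrix A A ℂ →ₗ[ℂ] Matrix B B ℂ)) :
    corrTable s t (∑ i, Φ i) = ∑ i, corrTable s t (Φ i) := by
  ext q
  simp [corrTable, Finset.sum_mul]

/-- A positive map is determined by its table on spanning sets of positive matrices. -/
theorem eq_of_corrTable_eq {A B : Type*} [Fintype B] {s : Finset (Matrix A A ℂ)} {t : Finset (Matrix B B ℂ)}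
    (hs : Submodule.span ℂ (s : Set (Matrix A A ℂ)) = ⊤)
    (ht : Submodule.span ℂ (t : Set (Matrix B B ℂ)) = ⊤)
    (htp : ∀ y ∈ t, y.PosSemidef) {Φ Ψ : Matrix A A ℂ →ₗ[ℂ] Matrix B B ℂ}
    (hΦ : ∀ x ∈ s, (Φ x).PosSemidef) (hΨ : ∀ x ∈ s, (Ψ x).PosSemidef)
    (h : corrTable s t Φ = corrTable s t Ψ) : Φ = Ψ := by
  refine LinearMap.ext_on hs fun x hx => Matrix.ext_iff_trace_mul_right.2 fun y => ?_
  have key : (Matrix.traceLinearMap B ℂ ℂ).comp (LinearMap.mulLeft ℂ (Φ x)) =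
      (Matrix.traceLinearMap B ℂ ℂ).comp (LinearMap.mulLeft ℂ (Ψ x)) := by
    refine LinearMap.ext_on ht fun y hy => ?_
    have := congrFun h (⟨x, hx⟩, ⟨y, hy⟩)
    simp only [corrTable] at this
    change (Φ x * y).trace = (Ψ x * y).trace
    -- Positivity makes these traces real, so the real parts in the tables determine them.
    rw [← ofReal_re_of_nonneg (trace_mul_nonneg (hΦ x hx) (htp y hy)),
      ← ofReal_re_of_nonneg (trace_mul_nonneg (hΨ x hx) (htp y hy)), this]
  exact LinearMap.congr_fun key y

/-- The trace of `Φ 1` is a fixed linear functional of the table of `Φ`. -/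
theorem exists_trace_functional {A B : Type*} [Fintype B] [DecidableEq A] {s : Finset (Matrix A A ℂ)}
    {t : Finset (Matrix B B ℂ)} (hs : Submodule.span ℂ (s : Set (Matrix A A ℂ)) = ⊤)
    (ht : Submodule.span ℂ (t : Set (Matrix B B ℂ)) = ⊤) (htp : ∀ y ∈ t, y.PosSemidef) :
    ∃ ν : s × t → ℝ, ∀ Φ : Matrix A A ℂ →ₗ[ℂ] Matrix B B ℂ, (∀ x ∈ s, (Φ x).PosSemidef) →
      ∑ q, ν q * corrTable s t Φ q = (Φ 1).trace.re := by
  classical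
  have h1 : (1 : Matrix A A ℂ) ∈ Submodule.span ℂ (Set.range fun x : s => (x : Matrix A A ℂ)) := by
    rw [Subtype.range_coe_subtype]; exact hs ▸ Submodule.mem_top
  have h2 : (1 : Matrix B B ℂ) ∈ Submodule.span ℂ (Set.range fun x : t => (x : Matrix B B ℂ)) := by
    rw [Subtype.range_coe_subtype]; exact ht ▸ Submodule.mem_top
  obtain ⟨c, hc⟩ := (Submodule.mem_span_range_iff_exists_fun ℂ).1 h1
  obtain ⟨e, he⟩ := (Submodule.mem_span_range_iff_exists_fun ℂ).1 h2
  -- Expand both identity matrices in `Tr[Φ(1) 1]`; table entries are real, so only the real parts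
  -- of the coefficients matter.
  refine ⟨fun q => (c q.1 * e q.2).re, fun Φ hΦ => ?_⟩
  have h3 : ∀ q : s × t, (c q.1 * e q.2).re * corrTable s t Φ q =
      (c q.1 * (e q.2 * (Φ q.1 * q.2).trace)).re := by
    intro q
    rw [← mul_assoc, corrTable, ← Complex.re_mul_ofReal,
      ofReal_re_of_nonneg (trace_mul_nonneg (hΦ _ q.1.2) (htp _ q.2.2))]
  simp only [h3]
  rw [← Complex.re_sum, Fintype.sum_prod_type]
  congr 1
  conv_rhs => rw [← Matrix.mul_one (Φ 1), ← hc, ← he, map_sum]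
  simp only [map_smul, Finset.sum_mul, Finset.mul_sum, Matrix.trace_sum, Matrix.smul_mul,
    Matrix.mul_smul, Matrix.trace_smul, smul_eq_mul]
  rw [Finset.sum_comm]
  refine Finset.sum_congr rfl fun _ _ => Finset.sum_congr rfl fun _ _ => by ring

/-- Entanglement witness: a channel that is not entanglement-breaking is separated from all
measure-and-prepare maps. -/
theorem Channel.exists_witness [DecidableEq A] [Nonempty A] [Nonempty B] (N : Channel A B)
    (hN : ¬ N.IsEB) {s : Finset (Matrix A A ℂ)} {t : Finset (Matrix B B ℂ)}
    (hs : Submodule.span ℂ (s : Set (Matrix A A ℂ)) = ⊤)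
    (ht : Submodule.span ℂ (t : Set (Matrix B B ℂ)) = ⊤) (hsp : ∀ x ∈ s, x.PosSemidef)
    (htp : ∀ y ∈ t, y.PosSemidef) :
    ∃ ω : s × t → ℝ, 0 < ∑ q, ω q * corrTable s t N.map q ∧
      ∀ (F : Matrix A A ℂ) (G : Matrix B B ℂ), F.PosSemidef → G.PosSemidef →
        ∑ q, ω q * corrTable s t (prepMap F G) q ≤ 0 := by
  classical
  let D : ℝ := Fintype.card A
  have hD0 : 0 < D := Nat.cast_pos.2 Fintype.card_pos
  let P : Set (s × t → ℝ) := (fun q : Matrix A A ℂ × Matrix B B ℂ =>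
    corrTable s t (prepMap q.1 q.2)) '' ({F | IsDensity F} ×ˢ {G | IsDensity G})
  have hP : IsCompact (convexHull ℝ P) := by
    refine isCompact_convexHull_of_finiteDimensional
      ((isCompact_setOf_isDensity.prod isCompact_setOf_isDensity).image ?_)
    refine continuous_pi fun q => Complex.continuous_re.comp (Continuous.matrix_trace ?_)
    change Continuous fun p : Matrix A A ℂ × Matrix B B ℂ => ((p.1 * q.1).trace • p.2) * q.2
    fun_prop
  have hpos : ∀ {F : Matrix A A ℂ} {G : Matrix B B ℂ}, F.PosSemidef → G.PosSemidef →
      ∀ x ∈ s, (prepMap F G x).PosSemidef := fun hF hG x hx =>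
    hG.smul (trace_mul_nonneg hF (hsp x hx))
  have hNpos : ∀ x ∈ s, (N.map x).PosSemidef := fun x hx => N.cp.posSemidef (hsp x hx)
  -- The factor `D⁻¹` matches normalisations: `Tr N(1) = D`, while `Tr Φ(1) = 1` for the maps in
  -- `P`.
  have hnot : D⁻¹ • corrTable s t N.map ∉ convexHull ℝ P := by
    intro hmem
    obtain ⟨ι, _, w, z, hw, hw1, hz, hsum⟩ := mem_convexHull_iff_exists_fintype.1 hmem
    choose r hr hrz using hz
    have hE : ∀ i, (((D * w i : ℝ) : ℂ) • (r i).1).PosSemidef := fun i =>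
      (hr i).1.1.smul (Complex.zero_le_real.2 (mul_nonneg hD0.le (hw i)))
    have hprep : ∀ i, prepMap (((D * w i : ℝ) : ℂ) • (r i).1) (r i).2 =
        ((D * w i : ℝ) : ℂ) • prepMap (r i).1 (r i).2 := by
      intro i
      ext1 ρ
      simp [prepMap, smul_smul]
    refine hN (Channel.isEB_of_eq_sum_prepMap (fun i => ((D * w i : ℝ) : ℂ) • (r i).1)
      (fun i => (r i).2) hE (fun i => (hr i).2) ?_)
    refine eq_of_corrTable_eq hs ht htp hNpos (fun x hx => ?_) ?_
    · rw [LinearMap.sum_apply]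
      exact Matrix.posSemidef_sum _ fun i _ => hpos (hE i) (hr i).2.1 x hx
    · rw [corrTable_sum]
      simp only [hprep, corrTable_smul, mul_smul]
      rw [← Finset.smul_sum]
      have : ∑ i, w i • corrTable s t (prepMap (r i).1 (r i).2) = D⁻¹ • corrTable s t N.map := by
        rw [← hsum]
        exact Finset.sum_congr rfl fun i _ => by rw [← hrz]
      rw [this, smul_smul, mul_inv_cancel₀ hD0.ne', one_smul]
  obtain ⟨f, u, hf1, hf2⟩ := geometric_hahn_banach_closed_point (convex_convexHull ℝ P)
    hP.isClosed hnot
  obtain ⟨ν, hν⟩ := exists_trace_functional hs ht htp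
  have hf : ∀ z, f z = ∑ q, f (Pi.single q 1) * z q := by
    intro z
    conv_lhs => rw [← Finset.univ_sum_single z, map_sum]
    refine Finset.sum_congr rfl fun q _ => ?_
    rw [mul_comm, ← smul_eq_mul, ← map_smul, ← Pi.single_smul, smul_eq_mul, mul_one]
  -- The separating constant `u` is absorbed as `u * Tr Φ(1)`, which is linear in the table. The
  -- inequality becomes homogeneous and so extends from densities to all positive `F`, `G`.
  have hω : ∀ Φ : Matrix A A ℂ →ₗ[ℂ] Matrix B B ℂ, (∀ x ∈ s, (Φ x).PosSemidef) →
      ∑ q, (f (Pi.single q 1) - u * ν q) * corrTable s t Φ q =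
        f (corrTable s t Φ) - u * (Φ 1).trace.re := by
    intro Φ hΦ
    rw [hf, ← hν Φ hΦ, Finset.mul_sum, ← Finset.sum_sub_distrib]
    exact Finset.sum_congr rfl fun q _ => by ring
  refine ⟨fun q => f (Pi.single q 1) - u * ν q, ?_, fun F G hF hG => ?_⟩
  · rw [hω _ hNpos, N.tp 1, Matrix.trace_one]
    rw [map_smul, smul_eq_mul, lt_inv_mul_iff₀ hD0] at hf2
    simp only [Complex.natCast_re]
    change D * u < _ at hf2
    change 0 < _ - u * D
    linarith
  · obtain ⟨a, ρ, ha, hρ, rfl⟩ := exists_eq_smul_isDensity hF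
    obtain ⟨b, σ, hb, hσ, rfl⟩ := exists_eq_smul_isDensity hG
    have hprep : prepMap ((a : ℂ) • ρ) ((b : ℂ) • σ) = ((a * b : ℝ) : ℂ) • prepMap ρ σ := by
      ext1 τ
      change (((a : ℂ) • ρ) * τ).trace • ((b : ℂ) • σ) = ((a * b : ℝ) : ℂ) • ((ρ * τ).trace • σ)
      rw [Matrix.smul_mul, Matrix.trace_smul, smul_smul, smul_smul, smul_eq_mul, Complex.ofReal_mul]
      congr 1
      ring
    rw [hprep, corrTable_smul]
    have h1 : ∑ q, (f (Pi.single q 1) - u * ν q) * corrTable s t (prepMap ρ σ) q ≤ 0 := by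
      rw [hω _ (hpos hρ.1 hσ.1)]
      have h2 : (prepMap ρ σ 1).trace = 1 := by
        change ((ρ * 1).trace • σ).trace = 1
        rw [Matrix.mul_one, Matrix.trace_smul, hρ.2, hσ.2, smul_eq_mul, mul_one]
      have := hf1 _ (subset_convexHull ℝ P ⟨(ρ, σ), ⟨hρ, hσ⟩, rfl⟩)
      rw [h2, Complex.one_re]
      linarith
    have h3 : ∑ q, (f (Pi.single q 1) - u * ν q) * ((a * b) • corrTable s t (prepMap ρ σ)) q =
        (a * b) * ∑ q, (f (Pi.single q 1) - u * ν q) * corrTable s t (prepMap ρ σ) q := by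
      rw [Finset.mul_sum]
      exact Finset.sum_congr rfl fun q _ => by rw [Pi.smul_apply, smul_eq_mul]; ring
    rw [h3]
    exact mul_nonpos_of_nonneg_of_nonpos (mul_nonneg ha hb) h1

end Witness

/-! ### The game built from a witness -/

section WitnessGame

/-- A joint effect together with a positive operator on the first factor induces a positive operator
on the second factor. -/
theorem exists_posSemidef_trace_kronecker_mul {B C : Type*} [Fintype B] [Fintype C]
    {σ : Matrix B B ℂ} (hσ : σ.PosSemidef) {Q : Matrix (B × C) (B × C) ℂ} (hQ : Q.PosSemidef) :
    ∃ G : Matrix C C ℂ, G.PosSemidef ∧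
      ∀ y : Matrix C C ℂ, ((σ ⊗ₖ yᵀ) * Q).trace = (G * y).trace := by
  classical
  obtain ⟨R, rfl⟩ := exists_eq_conjTranspose_mul_self hσ
  have hQ' := hQ.mul_mul_conjTranspose_same (R ⊗ₖ (1 : Matrix C C ℂ))
  obtain ⟨Q', hQ'eq⟩ : ∃ Q', Q' = (R ⊗ₖ (1 : Matrix C C ℂ)) * Q * (R ⊗ₖ (1 : Matrix C C ℂ))ᴴ :=
    ⟨_, rfl⟩
  rw [← hQ'eq] at hQ'
  -- The partial trace over `B` of `(R ⊗ 1) Q (R ⊗ 1)†`, transposed to undo the transpose on `y`.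
  refine ⟨(∑ b, Q'.submatrix (Prod.mk b) (Prod.mk b))ᵀ, Matrix.PosSemidef.transpose
    (Matrix.posSemidef_sum _ fun b _ => hQ'.submatrix _), fun y => ?_⟩
  have h1 : (Rᴴ * R) ⊗ₖ yᵀ =
      (R ⊗ₖ (1 : Matrix C C ℂ))ᴴ * ((1 : Matrix B B ℂ) ⊗ₖ yᵀ) * (R ⊗ₖ (1 : Matrix C C ℂ)) := by
    rw [Matrix.conjTranspose_kronecker, ← Matrix.mul_kronecker_mul, ← Matrix.mul_kronecker_mul]
    simp
  have h2 : (((Rᴴ * R) ⊗ₖ yᵀ) * Q).trace = (((1 : Matrix B B ℂ) ⊗ₖ yᵀ) * Q').trace := by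
    rw [h1, hQ'eq, Matrix.mul_assoc, Matrix.mul_assoc, Matrix.trace_mul_comm]
    simp only [Matrix.mul_assoc]
  rw [h2, ← Matrix.trace_transpose (_ * y), Matrix.transpose_mul, Matrix.transpose_transpose]
  simp [Matrix.trace, Matrix.mul_apply, Fintype.sum_prod_type, Matrix.one_apply,
    Matrix.sum_apply, Finset.mul_sum]
  exact Finset.sum_comm

/-- The projection onto the maximally entangled state, completed to a POVM. -/
theorem exists_isPOVM_trace_mul {B : Type*} [Fintype B] [DecidableEq B] [Nonempty B] :
    ∃ (r : ℝ) (P : Matrix (B × B) (B × B) ℂ), 0 < r ∧ P.PosSemidef ∧ (1 - P).PosSemidef ∧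
      ∀ x y : Matrix B B ℂ, ((x ⊗ₖ yᵀ) * P).trace = r * (x * y).trace := by
  let v : B × B → ℂ := fun p => if p.1 = p.2 then 1 else 0
  let D : ℝ := Fintype.card B
  have hD0 : 0 < D := Nat.cast_pos.2 Fintype.card_pos
  have hD : (D : ℂ) ≠ 0 := Complex.ofReal_ne_zero.2 hD0.ne'
  have hvv : star v ⬝ᵥ v = (D : ℂ) := by
    simp [dotProduct, v, Fintype.sum_prod_type, D]
  let V := Matrix.vecMulVec v (star v)
  have hV : V.PosSemidef := Matrix.posSemidef_vecMulVec_self_star v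
  have hVV : V * V = (D : ℂ) • V := by
    rw [Matrix.vecMulVec_mul_vecMulVec, hvv]
    ext p q
    simp [V, Matrix.vecMulVec_apply, mul_left_comm]
  let P := ((D⁻¹ : ℝ) : ℂ) • V
  have hP : P.PosSemidef := hV.smul (Complex.zero_le_real.2 (inv_nonneg.2 hD0.le))
  have hPP : P * P = P := by
    simp only [P, Matrix.smul_mul, Matrix.mul_smul, hVV, smul_smul]
    congr 1
    rw [Complex.ofReal_inv, inv_mul_cancel₀ hD, mul_one]
  refine ⟨D⁻¹, P, inv_pos.2 hD0, hP, ?_, fun x y => ?_⟩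
  · have : 1 - P = (1 - P)ᴴ * (1 - P) := by
      rw [Matrix.conjTranspose_sub, Matrix.conjTranspose_one, hP.isHermitian.eq, mul_sub, sub_mul,
        sub_mul, hPP]
      simp
    rw [this]
    exact Matrix.posSemidef_conjTranspose_mul_self _
  · rw [Matrix.mul_smul, Matrix.trace_smul, smul_eq_mul]
    congr 1
    simp [Matrix.trace, Matrix.mul_apply, V, v, Matrix.vecMulVec_apply, Fintype.sum_prod_type]

/-- A measurement after an entanglement-breaking channel has nonpositive value under a witness. -/
theorem Channel.IsEB.sum_witness_nonpos {A B A' B' : Type*} [Fintype A] [Fintype B]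
    [Fintype A'] [DecidableEq A'] [Fintype B'] {s : Finset (Matrix A A ℂ)}
    {t : Finset (Matrix B B ℂ)} (ω : s × t → ℝ) {N : Channel A' B'} (hN : N.IsEB)
    (hω : ∀ (F : Matrix A A ℂ) (G : Matrix B B ℂ), F.PosSemidef →
      G.PosSemidef → ∑ q, ω q * corrTable s t (prepMap F G) q ≤ 0) (K : Matrix A' A ℂ)
    {Q : Matrix (B' × B) (B' × B) ℂ} (hQ : Q.PosSemidef) :
    ∑ q : s × t, ω q *
      ((N.map (conjMap K q.1) ⊗ₖ (q.2 : Matrix B B ℂ)ᵀ) * Q).trace.re ≤ 0 := by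
  obtain ⟨m, l, π, E, σ, hπ, -, hE, hσ, hN⟩ := hN
  choose G hG hGt using fun μ j =>
    exists_posSemidef_trace_kronecker_mul (hσ μ j).1 hQ
  -- Pull the channel's effects back through `K` and turn its prepared states into effects on `B`
  -- through `Q`: the branch becomes a mixture of maps `prepMap`.
  have h1 : ∀ q : s × t,
      ((N.map (conjMap K q.1) ⊗ₖ (q.2 : Matrix B B ℂ)ᵀ) * Q).trace.re =
      ∑ μ, π μ * ∑ j, corrTable s t (prepMap (Kᴴ * E μ j * K) (G μ j)) q := by
    intro q
    have h2 : N.map (conjMap K q.1) ⊗ₖ (q.2 : Matrix B B ℂ)ᵀ =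
        ∑ μ, (π μ : ℂ) • ∑ j, (E μ j * conjMap K q.1).trace •
          (σ μ j ⊗ₖ (q.2 : Matrix B B ℂ)ᵀ) := by
      rw [hN]
      ext ⟨b, y⟩ ⟨b', y'⟩
      simp [Matrix.kroneckerMap_apply, Matrix.sum_apply, Finset.sum_mul, mul_assoc]
    rw [h2]
    simp only [Finset.sum_mul, Matrix.trace_sum, Matrix.smul_mul, Matrix.trace_smul, smul_eq_mul,
      Complex.re_sum, Complex.re_ofReal_mul]
    refine Finset.sum_congr rfl fun μ _ => ?_
    congr 1
    refine Finset.sum_congr rfl fun j _ => ?_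
    rw [corrTable_prepMap, hGt, conjMap_apply]
    congr 2
    rw [← Matrix.mul_assoc, Matrix.trace_mul_comm]
    simp only [Matrix.mul_assoc]
  have h3 : ∑ q : s × t, ω q *
      ((N.map (conjMap K q.1) ⊗ₖ (q.2 : Matrix B B ℂ)ᵀ) * Q).trace.re =
      ∑ μ, π μ * ∑ j, ∑ q, ω q *
        corrTable s t (prepMap (Kᴴ * E μ j * K) (G μ j)) q := by
    simp only [h1, Finset.mul_sum]
    rw [Finset.sum_comm]
    refine Finset.sum_congr rfl fun μ _ => ?_
    rw [Finset.sum_comm]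
    exact Finset.sum_congr rfl fun _ _ => Finset.sum_congr rfl fun _ _ => by ring
  refine h3.trans_le (Finset.sum_nonpos fun μ _ => mul_nonpos_of_nonneg_of_nonpos (hπ μ)
    (Finset.sum_nonpos fun j _ => hω _ _ (((hE μ).1 j).conjTranspose_mul_mul_same K) (hG μ j)))

variable {A B : Type u} [Fintype A] [DecidableEq A] [Fintype B] [DecidableEq B]

/-- The game in which Bob is asked to answer `true` or `false`, only the answer `true` being paid,
with question states `x ∈ s` and `yᵀ`, `y ∈ t`. -/
def witnessGame (s : Finset (Matrix A A ℂ)) (t : Finset (Matrix B B ℂ))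
    (hs : ∀ x ∈ s, IsDensity x) (ht : ∀ y ∈ t, IsDensity y) (hs0 : s.Nonempty) (ht0 : t.Nonempty)
    (ω : s × t → ℝ) : Game.{u} where
  X := s
  Y := t
  Ans := ULift Bool
  HX := A
  HY := B
  nonemptyX := hs0.to_subtype
  nonemptyY := ht0.to_subtype
  ξ x := x
  -- The transpose cancels the one produced by the maximally entangled projection.
  ψ y := (y : Matrix B B ℂ)ᵀ
  isDensity_ξ x := hs x x.2
  isDensity_ψ y := ⟨(ht y y.2).1.transpose, by rw [Matrix.trace_transpose]; exact (ht y y.2).2⟩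
  payoff b x y := if b.down then ω (x, y) else 0

variable {s : Finset (Matrix A A ℂ)} {t : Finset (Matrix B B ℂ)}
    (hs : ∀ x ∈ s, IsDensity x) (ht : ∀ y ∈ t, IsDensity y) (hs0 : s.Nonempty) (ht0 : t.Nonempty)
    (ω : s × t → ℝ)

theorem witnessGame_krausPayoff {A' B' : Type*} [Fintype A'] [Fintype B'] (N : Channel A' B')
    (K : Matrix A' A ℂ) (M : ULift.{u} Bool → Matrix (B' × B) (B' × B) ℂ) :
    (witnessGame s t hs ht hs0 ht0 ω).krausPayoff N K M =
      ∑ q : s × t, ω q *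
        ((N.map (conjMap K q.1) ⊗ₖ (q.2 : Matrix B B ℂ)ᵀ) * M ⟨true⟩).trace.re := by
  rw [Fintype.sum_prod_type]
  change ∑ b : ULift Bool, ∑ x : s, ∑ y : t, (if b.down then ω (x, y) else 0) *
    ((N.map (conjMap K x) ⊗ₖ (y : Matrix B B ℂ)ᵀ) * M b).trace.re = _
  rw [← Equiv.ulift.symm.sum_comp, Fintype.sum_bool]
  simp

theorem witnessGame_expectedPayoff_eq_zero {p : ULift.{u} Bool → s → t → ℝ}
    (hp : ∀ x y, p ⟨true⟩ x y = 0) : (witnessGame s t hs ht hs0 ht0 ω).expectedPayoff p = 0 := by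
  refine Finset.sum_eq_zero fun b _ => Finset.sum_eq_zero fun x _ => Finset.sum_eq_zero fun y _ => ?_
  rcases b with ⟨_ | _⟩
  · exact zero_mul _
  · exact mul_eq_zero_of_right _ (hp x y)

/-- Constant answer `false` attains 0; the witness inequality bounds each Kraus branch by 0,
whatever the dimensions of the channel. -/
theorem witnessGame_isEBThreshold (hω : ∀ (F : Matrix A A ℂ) (G : Matrix B B ℂ), F.PosSemidef →
    G.PosSemidef → ∑ q, ω q * corrTable s t (prepMap F G) q ≤ 0) :
    (witnessGame s t hs ht hs0 ht0 ω).IsEBThreshold 0 := by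
  intro A' B' _ _ _ _ _ _ N hN
  classical
  refine ⟨⟨_, (witnessGame s t hs ht hs0 ht0 ω).isAdmissible_const N (⟨false⟩ : ULift Bool),
    (witnessGame_expectedPayoff_eq_zero hs ht hs0 ht0 ω fun x y => if_neg fun h =>
      Bool.noConfusion (congrArg ULift.down h)).symm⟩, ?_⟩
  rw [Game.setOf_payoff_eq]
  rintro _ ⟨n, K, M, -, hM, rfl⟩
  refine Finset.sum_nonpos fun i _ => ?_
  refine (witnessGame_krausPayoff hs ht hs0 ht0 ω N (K i) (M i)).trans_le ?_
  exact hN.sum_witness_nonpos ω hω (K i) ((hM i).1 ⟨true⟩)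

/-- The honest strategy feeds the question into `N` unchanged and tests for the maximally entangled
state, earning `r` times the witness value of `N`. -/
theorem witnessGame_exists_pos [Nonempty A] [Nonempty B] (N : Channel A B)
    (hω : 0 < ∑ q, ω q * corrTable s t N.map q) :
    ∃ v, (witnessGame s t hs ht hs0 ht0 ω).IsOptimalPayoff N v ∧ 0 < v := by
  obtain ⟨v, hv⟩ := (witnessGame s t hs ht hs0 ht0 ω).exists_isOptimalPayoff N
  refine ⟨v, hv, ?_⟩
  obtain ⟨r, P, hr, hP, hP1, htr⟩ := exists_isPOVM_trace_mul (B := B)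
  let M : ULift.{u} Bool → Matrix (B × B) (B × B) ℂ := fun b => if b.down then P else 1 - P
  have hM : IsPOVM M := by
    refine ⟨?_, ?_⟩
    · rintro ⟨_ | _⟩
      · exact hP1
      · exact hP
    · rw [← Equiv.ulift.symm.sum_comp, Fintype.sum_bool]
      exact add_sub_cancel P 1
  have hmem : (witnessGame s t hs ht hs0 ht0 ω).krausPayoff N (1 : Matrix A A ℂ) M ∈
      {w : ℝ | ∃ p, (witnessGame s t hs ht hs0 ht0 ω).toScenario.IsAdmissible N p ∧
        w = (witnessGame s t hs ht hs0 ht0 ω).expectedPayoff p} := by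
    rw [Game.setOf_payoff_eq]
    refine ⟨1, fun _ => (1 : Matrix A A ℂ), fun _ => M, ?_, fun _ => hM, by simp⟩
    rw [Fin.sum_univ_one]
    exact (by simp : (1 : Matrix A A ℂ)ᴴ * 1 = 1)
  refine lt_of_lt_of_le ?_ (hv.2 hmem)
  rw [witnessGame_krausPayoff]
  have h : ∀ q : s × t, ω q * ((N.map (conjMap (1 : Matrix A A ℂ) q.1) ⊗ₖ
      (q.2 : Matrix B B ℂ)ᵀ) * M ⟨true⟩).trace.re = r * (ω q * corrTable s t N.map q) := by
    intro q
    change ω q * ((N.map (conjMap (1 : Matrix A A ℂ) q.1) ⊗ₖ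
      (q.2 : Matrix B B ℂ)ᵀ) * P).trace.re = r * (ω q * (N.map q.1 * q.2).trace.re)
    rw [htr, Complex.re_ofReal_mul, conjMap_apply]
    simp only [Matrix.conjTranspose_one, Matrix.one_mul, Matrix.mul_one]
    ring
  rw [Finset.sum_congr rfl fun q _ => h q, ← Finset.mul_sum]
  exact mul_pos hr hω

end WitnessGame
end QMemory

/-! ### The equivalence -/

theorem corollary1 {A B : Type u} [Fintype A] [DecidableEq A] [Nonempty A]
    [Fintype B] [DecidableEq B] [Nonempty B] (N : QMemory.Channel A B) :
    ¬ N.IsEB ↔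
      ∃ G : QMemory.Game.{u}, (∃ v : ℝ, G.IsOptimalPayoff N v ∧ 0 < v) ∧ G.IsEBThreshold 0 := by
  constructor
  · intro hN
    obtain ⟨s, hs, hss⟩ := QMemory.exists_finset_isDensity_span_eq_top (A := A)
    obtain ⟨t, ht, hts⟩ := QMemory.exists_finset_isDensity_span_eq_top (A := B)
    -- The empty set spans only 0, but the matrix space is nontrivial as `A` is nonempty.
    have hs0 : s.Nonempty := by
      rw [Finset.nonempty_iff_ne_empty]
      rintro rfl
      simp at hss
    have ht0 : t.Nonempty := by
      rw [Finset.nonempty_iff_ne_empty]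
      rintro rfl
      simp at hts
    obtain ⟨ω, hω, hω'⟩ := N.exists_witness hN hss hts (fun x hx => (hs x hx).1)
      fun y hy => (ht y hy).1
    exact ⟨QMemory.witnessGame s t hs ht hs0 ht0 ω,
      QMemory.witnessGame_exists_pos hs ht hs0 ht0 ω N hω,
      QMemory.witnessGame_isEBThreshold hs ht hs0 ht0 ω hω'⟩
  · rintro ⟨G, ⟨v, hv, hv0⟩, hG⟩ hN
    exact hv0.ne' (hv.unique (hG A B N hN))
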